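/- **Setting.** A *double category* $\mathbb A$ has objects, horizontal morphisms $\rightarrowtail$, vertical morphisms $\to_v$ (each forming a category on the same objects), and a class of *pseudo-commutative squares* with horizontal top and bottom and vertical left and right sides, determined by their boundary, containing identity squares and closed under horizontal and vertical pasting. It is an *ACGW category* if: horizontal and vertical isomorphisms are identified with each other (each isomorphism $a:X\to Y$ of one kind has a partner $a'$ of the other kind such that the squares with top $a$, left $a'$ and other sides identities, and with right $a'$, bottom $a$ and other sides identities, are pseudo-commutative; up to exchanging $a,a'$); there is an object $\varnothing$ initial for both kinds of morphisms; all morphisms are monic; pullbacks exist for both kinds; every $f:X\rightarrowtail Y$ has a cokernel $c(f):Y/X\to_v Y$ and every $g:X\to_v Y$ a kernel $k(g):Y\backslash X\rightarrowtail Y$, with $k(c(f))\cong f$ and $c(k(g))\cong g$ over $Y$; a morphism and its complement meet in $\varnothing$ (the square with upper left corner $\varnothing$, bottom $f$ and right side $c(f)$, resp. bottom $k(g)$ and right side $g$, is pseudo-commutative); and $c$ is natural: for fixed horizontal $t:X\rightarrowtail Y$, $b:Z\rightarrowtail W$ and vertical $r:Y\to_v W$, $c$ gives a bijection between the pseudo-commutative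 squares with top $t$, right side $r$, bottom $b$ and the pullback squares of vertical morphisms formed by $c(t)$, $r$, $c(b)$ and a morphism $Y/X\to_v W/Z$; and dually for $k$. It follows that every $A\rightarrowtail C\leftarrow_v B$ completes to a pseudo-commutative square, unique up to unique isomorphism, with corner $A\oslash_C B$. The *flattening* $\mathbb A^\flat$ is the category with the objects of $\mathbb A$, with isomorphism classes of spans $A\leftarrow_v\bar A\rightarrowtail B$ as morphisms $A\to B$, composed by means of $\oslash$. The zero morphisms are the classes of $A\leftarrow_v\varnothing\rightarrowtail B$. A *chain complex* $X_\bullet$ is a sequence of morphisms $d_i:X_i\to X_{i-1}$ ($i\in\mathbb Z$) of $\mathbb A^\flat$, $d_i=[X_i\leftarrow_v\bar X_i\rightarrowtail X_{i-1}]$, with $d_id_{i+1}=0$. A morphism $X_\bullet\to Y_\bullet$ is a sequence of morphisms $X_i\to Y_i$ of $\mathbb A^\flat$ commuting with the differentials. These form the category $\mathrm{Ch}_{\mathbb A}$. A horizontal (vertical) morphism of chain complexes $X_\bullet\to Y_\bullet$ is a sequence of horizontal (vertical) morphisms $X_i\to Y_i$ such that there are horizontal (vertical) morphisms $\bar X_i\to\bar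 Y_i$ for which, in the horizontal case, the squares over $\bar X_i\to_v X_i$ are pseudo-commutative and those over $\bar X_i\rightarrowtail X_{i-1}$ commute; in the vertical case, the former commute and the latter are pseudo-commutative. Every morphism $X_\bullet\to Y_\bullet$ of $\mathrm{Ch}_{\mathbb A}$ is given by a span $X_\bullet\leftarrow_v Z_\bullet\rightarrowtail Y_\bullet$ of a vertical and a horizontal morphism of chain complexes. Put $K_X=X_i\backslash\bar X_i$ and $Q_X=X_i/\bar X_{i+1}$. Because $d_id_{i+1}=0$ there are induced morphisms $\bar X_{i+1}\rightarrowtail K_X$ and $\bar X_i\to_v Q_X$, and the *$i$-th homology* is $H_i(X_\bullet)=K_X/\bar X_{i+1}\cong Q_X\backslash\bar X_i$. * A horizontal morphism $Z_\bullet\rightarrowtail Y_\bullet$ induces $K_Z\rightarrowtail K_Y$. With $W=\bar Y_{i+1}\times_{K_Y}K_Z$, it induces the span $H_i(Z_\bullet)=K_Z/\bar Z_{i+1}\leftarrow_v K_Z/W\rightarrowtail K_Y/\bar Y_{i+1}=H_i(Y_\bullet)$; the left leg comes from $\bar Z_{i+1}\rightarrowtail W$, the right leg from the pseudo-commutative square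 complementary to the pullback square of $W$. * Dually, a vertical morphism $Z_\bullet\to_v X_\bullet$ induces $Q_Z\to_v Q_X$. With $V=\bar X_i\times_{Q_X}Q_Z$ (a pullback of vertical morphisms), it induces the span $H_i(X_\bullet)\cong Q_X\backslash\bar X_i\leftarrow_v Q_Z\backslash V\rightarrowtail Q_Z\backslash\bar Z_i\cong H_i(Z_\bullet)$. * For a morphism $f$ of chain complexes represented by a span $X_\bullet\leftarrow_v Z_\bullet\rightarrowtail Y_\bullet$, $H_i(f)$ is the composite in $\mathbb A^\flat$ of the morphism $H_i(X_\bullet)\to H_i(Z_\bullet)$ induced by $Z_\bullet\to_v X_\bullet$ and the morphism $H_i(Z_\bullet)\to H_i(Y_\bullet)$ induced by $Z_\bullet\rightarrowtail Y_\bullet$. **Theorem.** Let $\mathbb A$ be an ACGW category and $i\in\mathbb Z$. Then $H_i(f)$ does not depend on the span of chain complexes chosen to represent $f$, and $X_\bullet\mapsto H_i(X_\bullet)$, $f\mapsto H_i(f)$ is a functor $\mathrm{Ch}_{\mathbb A}\to\mathbb A^\flat$: it preserves identities and composition. -/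

import Mathlib

open CategoryTheory CategoryTheory.Limits

universe u v w

/-- The objects of a category structure `𝒞` on `Ob`, as a category of their own.  This allows to
use Mathlib's notions for two category structures on the same type of objects. -/
structure Wrap {Ob : Type u} (𝒞 : Category.{v} Ob) where
  ob : Ob

instance {Ob : Type u} (𝒞 : Category.{v} Ob) : Category.{v} (Wrap 𝒞) where
  Hom X Y := 𝒞.Hom X.ob Y.ob
  id X := 𝒞.id X.ob
  comp f g := 𝒞.comp f g
  id_comp f := 𝒞.id_comp f
  comp_id f := 𝒞.comp_id f
  assoc f g h := 𝒞.assoc f g h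

/-- The morphisms from `X` to `Y` in the category structure `𝒞`. -/
abbrev HomIn {Ob : Type u} (𝒞 : Category.{v} Ob) (X Y : Ob) : Type v := (⟨X⟩ : Wrap 𝒞) ⟶ ⟨Y⟩

set_option linter.checkUnivs false

/-- A double category whose squares are determined by their boundary: a class of objects with two
category structures (`hor`, `ver`) and a class of *pseudo-commutative squares*
```
  X --t--> Y
  |        |
  l        r
  v        v
  Z --b--> W
```
(`t`, `b` horizontal, `l`, `r` vertical; written `Sq t l r b`) which contains the identity squares
and is closed under horizontal and vertical pasting.  In an ACGW category a square is automatically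
determined by its boundary, because complementation maps the squares injectively to pullback
squares with the same right-hand side, all of whose sides are monic. -/
structure ThinDoubleCategory where
  Ob : Type u
  hor : Category.{v} Ob
  ver : Category.{w} Ob
  Sq : ∀ {X Y Z W : Ob}, HomIn hor X Y → HomIn ver X Z → HomIn ver Y W → HomIn hor Z W → Prop
  sq_hid : ∀ {X Z : Ob} (l : HomIn ver X Z), Sq (𝟙 _) l l (𝟙 _)
  sq_vid : ∀ {X Y : Ob} (t : HomIn hor X Y), Sq t (𝟙 _) (𝟙 _) t
  sq_hcomp : ∀ {X Y Y' Z W W' : Ob} {t : HomIn hor X Y} {t' : HomIn hor Y Y'}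
    {l : HomIn ver X Z} {r : HomIn ver Y W} {r' : HomIn ver Y' W'}
    {b : HomIn hor Z W} {b' : HomIn hor W W'},
    Sq t l r b → Sq t' r r' b' → Sq (t ≫ t') l r' (b ≫ b')
  sq_vcomp : ∀ {X Y Z W Z' W' : Ob} {t : HomIn hor X Y} {l : HomIn ver X Z}
    {r : HomIn ver Y W} {b : HomIn hor Z W} {l' : HomIn ver Z Z'} {r' : HomIn ver W W'}
    {b' : HomIn hor Z' W'},
    Sq t l r b → Sq b l' r' b' → Sq t (l ≫ l') (r ≫ r') b'

namespace ThinDoubleCategory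

/-- The category of objects and horizontal morphisms. -/
abbrev HorCat (D : ThinDoubleCategory.{u, v, w}) : Type u := Wrap D.hor

/-- The category of objects and vertical morphisms. -/
abbrev VerCat (D : ThinDoubleCategory.{u, v, w}) : Type u := Wrap D.ver

/-- Horizontal morphisms. -/
abbrev Hor (D : ThinDoubleCategory.{u, v, w}) (X Y : D.Ob) : Type v := HomIn D.hor X Y

/-- Vertical morphisms. -/
abbrev Ver (D : ThinDoubleCategory.{u, v, w}) (X Y : D.Ob) : Type w := HomIn D.ver X Y

/-- Horizontal isomorphisms. -/
abbrev HorIso (D : ThinDoubleCategory.{u, v, w}) (X Y : D.Ob) : Type v :=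
  (⟨X⟩ : D.HorCat) ≅ ⟨Y⟩

/-- Vertical isomorphisms. -/
abbrev VerIso (D : ThinDoubleCategory.{u, v, w}) (X Y : D.Ob) : Type w :=
  (⟨X⟩ : D.VerCat) ≅ ⟨Y⟩

abbrev hid (D : ThinDoubleCategory.{u, v, w}) (X : D.Ob) : D.Hor X X := 𝟙 (⟨X⟩ : D.HorCat)

abbrev vid (D : ThinDoubleCategory.{u, v, w}) (X : D.Ob) : D.Ver X X := 𝟙 (⟨X⟩ : D.VerCat)

/-- A horizontal and a vertical morphism with the same source and target *correspond* to each
other (are companions).  In the examples this identifies horizontal and vertical isomorphisms. -/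
def Corr (D : ThinDoubleCategory.{u, v, w}) {X Y : D.Ob} (a : D.Hor X Y) (b : D.Ver X Y) : Prop :=
  D.Sq a b (D.vid Y) (D.hid Y) ∧ D.Sq (D.hid X) (D.vid X) b a

end ThinDoubleCategory

/-- An ACGW category: a double category with an object `∅` initial in both directions, all of whose
morphisms are monic, which has pullbacks in both directions, and in which horizontal and vertical
morphisms to a given object determine each other through mutually inverse operations `coker` and
`ker`, natural in the sense that pseudo-commutative squares correspond to pullback squares of the
complements (`cokerSq`, `kerSq`). -/
structure ACGWCategory extends ThinDoubleCategory.{u, v, w} where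
  /-- Horizontal and vertical isomorphisms are identified with each other. -/
  exists_verIso : ∀ {X Y : Ob} (a : toThinDoubleCategory.HorIso X Y),
    ∃ b : toThinDoubleCategory.VerIso X Y, toThinDoubleCategory.Corr a.hom b.hom
  exists_horIso : ∀ {X Y : Ob} (b : toThinDoubleCategory.VerIso X Y),
    ∃ a : toThinDoubleCategory.HorIso X Y, toThinDoubleCategory.Corr a.hom b.hom
  /-- The object `∅`, initial in both directions. -/
  empty : Ob
  emptyHor : IsInitial (⟨empty⟩ : toThinDoubleCategory.HorCat)
  emptyVer : IsInitial (⟨empty⟩ : toThinDoubleCategory.VerCat)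
  /-- All morphisms are monic. -/
  hor_mono : ∀ {X Y : Ob} (f : toThinDoubleCategory.Hor X Y), Mono f
  ver_mono : ∀ {X Y : Ob} (g : toThinDoubleCategory.Ver X Y), Mono g
  /-- Pullbacks exist in both directions. -/
  hor_pullbacks : HasPullbacks toThinDoubleCategory.HorCat
  ver_pullbacks : HasPullbacks toThinDoubleCategory.VerCat
  /-- The cokernel `Y ⫽ X ⟶ Y` (vertical) of a horizontal morphism `X ⟶ Y`. -/
  cokerObj : ∀ {X Y : Ob}, toThinDoubleCategory.Hor X Y → Ob
  coker : ∀ {X Y : Ob} (f : toThinDoubleCategory.Hor X Y), toThinDoubleCategory.Ver (cokerObj f) Y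
  /-- The kernel `Y ⑊ X ⟶ Y` (horizontal) of a vertical morphism `X ⟶ Y`. -/
  kerObj : ∀ {X Y : Ob}, toThinDoubleCategory.Ver X Y → Ob
  ker : ∀ {X Y : Ob} (g : toThinDoubleCategory.Ver X Y), toThinDoubleCategory.Hor (kerObj g) Y
  /-- Kernel and cokernel are mutually inverse, up to isomorphism over the target. -/
  ker_coker : ∀ {X Y : Ob} (f : toThinDoubleCategory.Hor X Y),
    ∃ a : toThinDoubleCategory.HorIso (kerObj (coker f)) X, a.hom ≫ f = ker (coker f)
  coker_ker : ∀ {X Y : Ob} (g : toThinDoubleCategory.Ver X Y),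
    ∃ b : toThinDoubleCategory.VerIso (cokerObj (ker g)) X, b.hom ≫ g = coker (ker g)
  /-- A morphism and its complement meet in `∅`. -/
  sq_coker : ∀ {X Y : Ob} (f : toThinDoubleCategory.Hor X Y),
    Sq (emptyHor.to ⟨cokerObj f⟩) (emptyVer.to ⟨X⟩) (coker f) f
  sq_ker : ∀ {X Y : Ob} (g : toThinDoubleCategory.Ver X Y),
    Sq (emptyHor.to ⟨X⟩) (emptyVer.to ⟨kerObj g⟩) g (ker g)
  /-- Taking cokernels is a bijection from pseudo-commutative squares with a given right side `r`
  to pullback squares of vertical morphisms with right side `r`. -/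
  cokerSq : ∀ {X Y Z W : Ob} (t : toThinDoubleCategory.Hor X Y) (r : toThinDoubleCategory.Ver Y W)
    (b : toThinDoubleCategory.Hor Z W),
    {l : toThinDoubleCategory.Ver X Z // Sq t l r b} ≃
      {c : toThinDoubleCategory.Ver (cokerObj t) (cokerObj b) // IsPullback (coker t) c r (coker b)}
  /-- Taking kernels is a bijection from pseudo-commutative squares with a given bottom side `b`
  to pullback squares of horizontal morphisms with that side `b`. -/
  kerSq : ∀ {X Y Z W : Ob} (l : toThinDoubleCategory.Ver X Z) (b : toThinDoubleCategory.Hor Z W)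
    (r : toThinDoubleCategory.Ver Y W),
    {t : toThinDoubleCategory.Hor X Y // Sq t l r b} ≃
      {k : toThinDoubleCategory.Hor (kerObj l) (kerObj r) // IsPullback (ker l) k b (ker r)}

namespace ACGWCategory

variable {A : ACGWCategory.{u, v, w}}

instance (A : ACGWCategory.{u, v, w}) : HasPullbacks A.HorCat := A.hor_pullbacks

instance (A : ACGWCategory.{u, v, w}) : HasPullbacks A.VerCat := A.ver_pullbacks

instance {X Y : A.Ob} (f : A.Hor X Y) : Mono f := A.hor_mono f

instance {X Y : A.Ob} (g : A.Ver X Y) : Mono g := A.ver_mono g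

/-- The ACGW category with the two directions exchanged. -/
@[reducible] def transpose (A : ACGWCategory.{u, v, w}) : ACGWCategory.{u, w, v} where
  Ob := A.Ob
  hor := A.ver
  ver := A.hor
  Sq t l r b := A.Sq l t b r
  sq_hid l := A.sq_vid l
  sq_vid t := A.sq_hid t
  sq_hcomp h h' := A.sq_vcomp h h'
  sq_vcomp h h' := A.sq_hcomp h h'
  exists_verIso a := A.exists_horIso a
  exists_horIso b := A.exists_verIso b
  empty := A.empty
  emptyHor := A.emptyVer
  emptyVer := A.emptyHor
  hor_mono := A.ver_mono
  ver_mono := A.hor_mono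
  hor_pullbacks := A.ver_pullbacks
  ver_pullbacks := A.hor_pullbacks
  cokerObj f := A.kerObj f
  coker f := A.ker f
  kerObj g := A.cokerObj g
  ker g := A.coker g
  ker_coker f := A.coker_ker f
  coker_ker g := A.ker_coker g
  sq_coker f := A.sq_ker f
  sq_ker g := A.sq_coker g
  cokerSq t r b := A.kerSq t r b
  kerSq l b r := A.cokerSq l b r


section Squares

variable {X Y Z W X' Y' Z' : A.Ob}

theorem sq_left_unique {t : A.Hor X Y} {l l' : A.Ver X Z} {r : A.Ver Y W} {b : A.Hor Z W}
    (h : A.Sq t l r b) (h' : A.Sq t l' r b) : l = l' := by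
  have key : (⟨l, h⟩ : {l : A.Ver X Z // A.Sq t l r b}) = ⟨l', h'⟩ := by
    apply (A.cokerSq t r b).injective
    apply Subtype.ext
    rw [← cancel_mono (A.coker b), ← (A.cokerSq t r b ⟨l, h⟩).2.w,
      ← (A.cokerSq t r b ⟨l', h'⟩).2.w]
  exact congrArg Subtype.val key

theorem sq_top_unique {t t' : A.Hor X Y} {l : A.Ver X Z} {r : A.Ver Y W} {b : A.Hor Z W}
    (h : A.Sq t l r b) (h' : A.Sq t' l r b) : t = t' :=
  sq_left_unique (A := A.transpose) h h'

theorem corr_id (X : A.Ob) : A.Corr (A.hid X) (A.vid X) := ⟨A.sq_vid _, A.sq_vid _⟩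

theorem corr_comp {a : A.Hor X Y} {c : A.Ver X Y} {a' : A.Hor Y Z} {c' : A.Ver Y Z}
    (h : A.Corr a c) (h' : A.Corr a' c') : A.Corr (a ≫ a') (c ≫ c') := by
  constructor
  · have := A.sq_vcomp (A.sq_hcomp h.1 (A.sq_vid a')) (by simpa using h'.1)
    simpa using this
  · have := A.sq_vcomp h.2 (by simpa using A.sq_hcomp (A.sq_vid a) h'.2)
    simpa using this

theorem corr_symm {a : A.HorIso X Y} {c : A.VerIso X Y} (h : A.Corr a.hom c.hom) :
    A.Corr a.inv c.inv := by
  obtain ⟨c', hc'⟩ := A.exists_verIso a.symm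
  have h1 := corr_comp h hc'
  have h2 : c.hom ≫ c'.hom = 𝟙 _ := by
    refine sq_left_unique (t := A.hid X) (r := A.vid X) (b := A.hid X) ?_ (A.sq_vid _)
    simpa using h1.1
  have h3 : c'.hom = c.inv := by
    rw [← cancel_epi c.hom, h2, c.hom_inv_id]
  rw [← h3]
  exact hc'

/-- A square may be transported along an isomorphism of its upper left corner. -/
theorem sq_transport {a : A.Hor X' X} {c : A.Ver X' X} (h : A.Corr a c) {t : A.Hor X Y}
    {l : A.Ver X Z} {r : A.Ver Y W} {b : A.Hor Z W} (hs : A.Sq t l r b) :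
    A.Sq (a ≫ t) (c ≫ l) r b := by
  have := A.sq_vcomp (A.sq_hcomp h.1 (A.sq_vid t)) (by simpa using hs)
  simpa using this

theorem exists_coker_of_sq {t : A.Hor X Y} {l : A.Ver X Z} {r : A.Ver Y W} {b : A.Hor Z W}
    (h : A.Sq t l r b) : ∃ c : A.Ver (A.cokerObj t) (A.cokerObj b),
      IsPullback (A.coker t) c r (A.coker b) :=
  ⟨_, (A.cokerSq t r b ⟨l, h⟩).2⟩

theorem exists_left_of_isPullback {t : A.Hor X Y} {r : A.Ver Y W} {b : A.Hor Z W}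
    {c : A.Ver (A.cokerObj t) (A.cokerObj b)} (h : IsPullback (A.coker t) c r (A.coker b)) :
    ∃ l : A.Ver X Z, A.Sq t l r b :=
  ⟨_, ((A.cokerSq t r b).symm ⟨c, h⟩).2⟩

theorem exists_ker_of_sq {t : A.Hor X Y} {l : A.Ver X Z} {r : A.Ver Y W} {b : A.Hor Z W}
    (h : A.Sq t l r b) : ∃ k : A.Hor (A.kerObj l) (A.kerObj r),
      IsPullback (A.ker l) k b (A.ker r) :=
  exists_coker_of_sq (A := A.transpose) h

theorem exists_top_of_isPullback {l : A.Ver X Z} {r : A.Ver Y W} {b : A.Hor Z W}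
    {k : A.Hor (A.kerObj l) (A.kerObj r)} (h : IsPullback (A.ker l) k b (A.ker r)) :
    ∃ t : A.Hor X Y, A.Sq t l r b :=
  exists_left_of_isPullback (A := A.transpose) h

/-- Mixed pullbacks exist. -/
theorem exists_sq (b : A.Hor Z W) (r : A.Ver Y W) :
    ∃ (P : A.Ob) (t : A.Hor P Y) (l : A.Ver P Z), A.Sq t l r b := by
  let p : A.Ver (pullback r (A.coker b)).ob Y := pullback.fst r (A.coker b)
  obtain ⟨i, hi⟩ := A.coker_ker p
  have h : IsPullback (A.coker (A.ker p)) (i.hom ≫ pullback.snd r (A.coker b)) r (A.coker b) :=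
    IsPullback.of_iso (IsPullback.of_hasPullback r (A.coker b)) i.symm (Iso.refl _) (Iso.refl _)
      (Iso.refl _) (by simp [← hi, p]) (by simp) (by simp) (by simp)
  obtain ⟨l, hl⟩ := exists_left_of_isPullback h
  exact ⟨_, _, l, hl⟩

/-- Mixed pullbacks are unique up to isomorphism. -/
theorem sq_unique {t : A.Hor X Y} {l : A.Ver X Z} {t' : A.Hor X' Y} {l' : A.Ver X' Z}
    {r : A.Ver Y W} {b : A.Hor Z W} (h : A.Sq t l r b) (h' : A.Sq t' l' r b) :
    ∃ (a : A.HorIso X X') (c : A.VerIso X X'),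
      A.Corr a.hom c.hom ∧ a.hom ≫ t' = t ∧ c.hom ≫ l' = l := by
  have key : ∀ {X X' : A.Ob} {t : A.Hor X Y} {l : A.Ver X Z} {t' : A.Hor X' Y} {l' : A.Ver X' Z},
      A.Sq t l r b → A.Sq t' l' r b → ∃ z : A.Ver X X', A.Sq t z (A.vid Y) t' := by
    intro X X' t l t' l' h h'
    obtain ⟨c, hc⟩ := exists_coker_of_sq h
    obtain ⟨c', hc'⟩ := exists_coker_of_sq h'
    let i := hc.isoIsPullback _ _ hc'
    have hi : i.hom ≫ A.coker t' = A.coker t := hc.isoIsPullback_hom_fst _ _ hc'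
    exact exists_left_of_isPullback (c := i.hom)
      (IsPullback.of_horiz_isIso_mono ⟨by simp [hi]⟩ |>.flip)
  obtain ⟨z, hz⟩ := key h h'
  obtain ⟨z', hz'⟩ := key h' h
  let c : A.VerIso X X' :=
    { hom := z
      inv := z'
      hom_inv_id := sq_left_unique (by simpa using A.sq_vcomp hz hz') (A.sq_vid t)
      inv_hom_id := sq_left_unique (by simpa using A.sq_vcomp hz' hz) (A.sq_vid t') }
  obtain ⟨a, ha⟩ := A.exists_horIso c
  refine ⟨a, c, ha, ?_, ?_⟩
  · refine sq_top_unique (l := z) (r := A.vid Y) (b := t') ?_ hz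
    simpa using A.sq_hcomp ha.1 (A.sq_vid t')
  · exact sq_left_unique (by simpa using A.sq_vcomp hz h') h

end Squares

/-! ### The flattening -/

/-- A diagram `X ⟵ mid ⟶ Y` with a vertical left leg and a horizontal right leg. -/
structure Span (A : ACGWCategory.{u, v, w}) (X Y : A.Ob) where
  mid : A.Ob
  e : A.Ver mid X
  m : A.Hor mid Y

/-- Isomorphism of spans. -/
def Span.Rel {X Y : A.Ob} (s t : A.Span X Y) : Prop :=
  ∃ (a : A.HorIso s.mid t.mid) (c : A.VerIso s.mid t.mid),
    A.Corr a.hom c.hom ∧ a.hom ≫ t.m = s.m ∧ c.hom ≫ t.e = s.e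

theorem Span.Rel.refl {X Y : A.Ob} (s : A.Span X Y) : s.Rel s :=
  ⟨Iso.refl _, Iso.refl _, corr_id _, by simp, by simp⟩

theorem Span.Rel.symm {X Y : A.Ob} {s t : A.Span X Y} (h : s.Rel t) : t.Rel s := by
  obtain ⟨a, c, h1, h2, h3⟩ := h
  exact ⟨a.symm, c.symm, corr_symm h1, by simp [← h2], by simp [← h3]⟩

theorem Span.Rel.trans {X Y : A.Ob} {s t r : A.Span X Y} (h : s.Rel t) (h' : t.Rel r) :
    s.Rel r := by
  obtain ⟨a, c, h1, h2, h3⟩ := h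
  obtain ⟨a', c', h1', h2', h3'⟩ := h'
  exact ⟨a ≪≫ a', c ≪≫ c', corr_comp h1 h1', by simp [h2, h2'], by simp [h3, h3']⟩

instance spanSetoid (A : ACGWCategory.{u, v, w}) (X Y : A.Ob) : Setoid (A.Span X Y) where
  r := Span.Rel
  iseqv := ⟨Span.Rel.refl, Span.Rel.symm, Span.Rel.trans⟩

/-- The span obtained from `s` and `t` by means of a square filling the cospan
`s.mid ⟶ Y ⟵ t.mid`. -/
def Span.glue {X Y Z : A.Ob} (s : A.Span X Y) (t : A.Span Y Z) {P : A.Ob}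
    (p : A.Hor P t.mid) (q : A.Ver P s.mid) : A.Span X Z where
  mid := P
  e := q ≫ s.e
  m := p ≫ t.m

theorem Span.glue_rel {X Y Z : A.Ob} {s s' : A.Span X Y} {t t' : A.Span Y Z} {P P' : A.Ob}
    {p : A.Hor P t.mid} {q : A.Ver P s.mid} {p' : A.Hor P' t'.mid} {q' : A.Ver P' s'.mid}
    (h : A.Sq p q t.e s.m) (h' : A.Sq p' q' t'.e s'.m) (hs : s.Rel s') (ht : t.Rel t') :
    (s.glue t p q).Rel (s'.glue t' p' q') := by
  obtain ⟨a, c, h1, h2, h3⟩ := hs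
  obtain ⟨a', c', h1', h2', h3'⟩ := ht
  have k1 : A.Sq (p ≫ a'.hom) (q ≫ c.hom) t'.e s'.m := by
    have e1 : A.Sq p (𝟙 _) c'.hom (p ≫ a'.hom) := by
      simpa using A.sq_hcomp (A.sq_vid p) h1'.2
    have e2 : A.Sq a'.hom c'.hom (𝟙 _) (𝟙 _) := h1'.1
    have e3 : A.Sq (p ≫ a'.hom) q t'.e s.m := by
      have f1 : A.Sq a'.hom t.e t'.e (𝟙 _) := by
        have := A.sq_vcomp h1'.1 (A.sq_hid t'.e)
        simpa [h3'] using this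
      simpa using A.sq_hcomp h f1
    have e4 : A.Sq s.m c.hom (𝟙 _) s'.m := by
      have := A.sq_hcomp h1.1 (A.sq_vid s'.m)
      simpa [h2] using this
    simpa using A.sq_vcomp e3 e4
  obtain ⟨b, d, g1, g2, g3⟩ := sq_unique k1 h'
  refine ⟨b, d, g1, ?_, ?_⟩
  · change b.hom ≫ p' ≫ t'.m = p ≫ t.m
    rw [← Category.assoc, g2, Category.assoc, h2']
  · change d.hom ≫ q' ≫ s'.e = q ≫ s.e
    rw [← Category.assoc, g3, Category.assoc, h3]

/-- The middle object `s.mid ⊘_Y t.mid` of the composite of two spans. -/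
noncomputable def Span.compMid {X Y Z : A.Ob} (s : A.Span X Y) (t : A.Span Y Z) : A.Ob :=
  (exists_sq s.m t.e).choose

noncomputable def Span.compTop {X Y Z : A.Ob} (s : A.Span X Y) (t : A.Span Y Z) :
    A.Hor (s.compMid t) t.mid :=
  (exists_sq s.m t.e).choose_spec.choose

noncomputable def Span.compLeft {X Y Z : A.Ob} (s : A.Span X Y) (t : A.Span Y Z) :
    A.Ver (s.compMid t) s.mid :=
  (exists_sq s.m t.e).choose_spec.choose_spec.choose

theorem Span.comp_sq {X Y Z : A.Ob} (s : A.Span X Y) (t : A.Span Y Z) :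
    A.Sq (s.compTop t) (s.compLeft t) t.e s.m :=
  (exists_sq s.m t.e).choose_spec.choose_spec.choose_spec

/-- Composition of spans. -/
noncomputable def Span.comp {X Y Z : A.Ob} (s : A.Span X Y) (t : A.Span Y Z) : A.Span X Z :=
  s.glue t (s.compTop t) (s.compLeft t)

/-- The flattening `A^♭`: its objects are those of `A`, its morphisms are the isomorphism classes
of spans. -/
structure Flat (A : ACGWCategory.{u, v, w}) where
  ob : A.Ob

/-- The class of a span. -/
def Span.cls {X Y : A.Ob} (s : A.Span X Y) : Quotient (A.spanSetoid X Y) := Quotient.mk _ s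

noncomputable instance (A : ACGWCategory.{u, v, w}) :
    CategoryStruct.{max u v w} A.Flat where
  Hom X Y := Quotient (A.spanSetoid X.ob Y.ob)
  id X := Span.cls ⟨X.ob, 𝟙 _, 𝟙 _⟩
  comp f g := Quotient.map₂ Span.comp
    (fun s s' hs t t' ht => Span.glue_rel (s.comp_sq t) (s'.comp_sq t') hs ht) f g

/-- The morphism of `A^♭` represented by a span. -/
def Span.hom {X Y : A.Ob} (s : A.Span X Y) : (⟨X⟩ : A.Flat) ⟶ ⟨Y⟩ := s.cls

theorem Span.hom_eq_iff {X Y : A.Ob} (s t : A.Span X Y) : s.hom = t.hom ↔ s.Rel t :=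
  Quotient.eq (r := A.spanSetoid X Y)

theorem Span.hom_comp {X Y Z : A.Ob} (s : A.Span X Y) (t : A.Span Y Z) {P : A.Ob}
    {p : A.Hor P t.mid} {q : A.Ver P s.mid} (h : A.Sq p q t.e s.m) :
    s.hom ≫ t.hom = (s.glue t p q).hom := by
  change (s.comp t).hom = _
  rw [Span.hom_eq_iff]
  exact Span.glue_rel (s.comp_sq t) h (Span.Rel.refl _) (Span.Rel.refl _)

theorem Flat.exists_rep {X Y : A.Flat} (f : X ⟶ Y) : ∃ s : A.Span X.ob Y.ob, s.hom = f :=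
  Quotient.exists_rep f

noncomputable instance (A : ACGWCategory.{u, v, w}) : Category.{max u v w} A.Flat where
  id_comp {X Y} f := by
    obtain ⟨s, rfl⟩ := Flat.exists_rep f
    refine (Span.hom_comp ⟨X.ob, 𝟙 _, 𝟙 _⟩ s (A.sq_hid s.e)).trans ?_
    congr 1
    simp [Span.glue]
  comp_id {X Y} f := by
    obtain ⟨s, rfl⟩ := Flat.exists_rep f
    refine (Span.hom_comp s ⟨Y.ob, 𝟙 _, 𝟙 _⟩ (A.sq_vid s.m)).trans ?_
    congr 1
    simp [Span.glue]
  assoc {X Y Z W} f g h := by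
    obtain ⟨s, rfl⟩ := Flat.exists_rep f
    obtain ⟨t, rfl⟩ := Flat.exists_rep g
    obtain ⟨r, rfl⟩ := Flat.exists_rep h
    have e1 := s.comp_sq t
    have e2 := t.comp_sq r
    obtain ⟨P, p, q, e3⟩ := exists_sq (s.compTop t) (t.compLeft r)
    have l1 : (s.hom ≫ t.hom) ≫ r.hom = ((s.comp t).glue r (p ≫ t.compTop r) q).hom := by
      rw [Span.hom_comp s t e1]
      exact Span.hom_comp _ r (A.sq_hcomp e3 e2)
    have l2 : s.hom ≫ t.hom ≫ r.hom = (s.glue (t.comp r) p (q ≫ s.compLeft t)).hom := by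
      rw [Span.hom_comp t r e2]
      exact Span.hom_comp s _ (A.sq_vcomp e3 e1)
    refine l1.trans (Eq.trans ?_ l2.symm)
    congr 1
    simp [Span.glue, Span.comp]

/-- A span representing a morphism of `A^♭`. -/
noncomputable def Flat.rep {X Y : A.Flat} (f : X ⟶ Y) : A.Span X.ob Y.ob :=
  (Flat.exists_rep f).choose

theorem Flat.rep_hom {X Y : A.Flat} (f : X ⟶ Y) : (Flat.rep f).hom = f :=
  (Flat.exists_rep f).choose_spec

/-- A horizontal morphism as a morphism of `A^♭`. -/
def ofHor {X Y : A.Ob} (f : A.Hor X Y) : (⟨X⟩ : A.Flat) ⟶ ⟨Y⟩ := Span.hom ⟨X, 𝟙 _, f⟩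

/-- A vertical morphism as a morphism of `A^♭` in the opposite direction. -/
def ofVer {X Y : A.Ob} (g : A.Ver X Y) : (⟨Y⟩ : A.Flat) ⟶ ⟨X⟩ := Span.hom ⟨X, g, 𝟙 _⟩

theorem Span.comp_ofHor {X Y Z : A.Ob} (s : A.Span X Y) (f : A.Hor Y Z) :
    s.hom ≫ ofHor f = Span.hom ⟨s.mid, s.e, s.m ≫ f⟩ := by
  refine (Span.hom_comp s ⟨Y, 𝟙 _, f⟩ (A.sq_vid s.m)).trans ?_
  congr 1
  simp [Span.glue]

theorem Span.ofVer_comp {X Y Z : A.Ob} (g : A.Ver Y X) (s : A.Span Y Z) :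
    ofVer g ≫ s.hom = Span.hom ⟨s.mid, s.e ≫ g, s.m⟩ := by
  refine (Span.hom_comp ⟨Y, g, 𝟙 _⟩ s (A.sq_hid s.e)).trans ?_
  congr 1
  simp [Span.glue]

theorem Span.ofHor_comp {X Y Z : A.Ob} (f : A.Hor X Y) (s : A.Span Y Z) {P : A.Ob}
    {p : A.Hor P s.mid} {q : A.Ver P X} (h : A.Sq p q s.e f) :
    ofHor f ≫ s.hom = Span.hom ⟨P, q, p ≫ s.m⟩ := by
  refine (Span.hom_comp ⟨X, 𝟙 _, f⟩ s h).trans ?_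
  congr 1
  simp [Span.glue]

theorem Span.comp_ofVer {X Y Z : A.Ob} (s : A.Span X Y) (g : A.Ver Z Y) {P : A.Ob}
    {p : A.Hor P Z} {q : A.Ver P s.mid} (h : A.Sq p q g s.m) :
    s.hom ≫ ofVer g = Span.hom ⟨P, q ≫ s.e, p⟩ := by
  refine (Span.hom_comp s ⟨Z, g, 𝟙 _⟩ h).trans ?_
  congr 1
  simp [Span.glue]

theorem Span.hom_eq {X Y : A.Ob} (s : A.Span X Y) : s.hom = ofVer s.e ≫ ofHor s.m := by
  refine ((Span.comp_ofHor ⟨s.mid, s.e, 𝟙 _⟩ s.m).trans ?_).symm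
  congr 1
  simp

instance {X Y : A.Ob} (f : A.Hor X Y) : Mono (ofHor f) where
  right_cancellation {Z} g h e := by
    obtain ⟨s, rfl⟩ := Flat.exists_rep g
    obtain ⟨t, rfl⟩ := Flat.exists_rep h
    have e1 := (Span.comp_ofHor s f).symm.trans (e.trans (Span.comp_ofHor t f))
    rw [Span.hom_eq_iff] at e1 ⊢
    obtain ⟨a, c, h1, h2, h3⟩ := e1
    refine ⟨a, c, h1, ?_, h3⟩
    simpa [← Category.assoc, cancel_mono] using h2

instance {X Y : A.Ob} (g : A.Ver X Y) : Epi (ofVer g) where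
  left_cancellation {Z} f h e := by
    obtain ⟨s, rfl⟩ := Flat.exists_rep f
    obtain ⟨t, rfl⟩ := Flat.exists_rep h
    have e1 := (Span.ofVer_comp g s).symm.trans (e.trans (Span.ofVer_comp g t))
    rw [Span.hom_eq_iff] at e1 ⊢
    obtain ⟨a, c, h1, h2, h3⟩ := e1
    refine ⟨a, c, h1, h2, ?_⟩
    simpa [← Category.assoc, cancel_mono] using h3

/-- The zero span `X ⟵ ∅ ⟶ Y`. -/
def zeroSpan (A : ACGWCategory.{u, v, w}) (X Y : A.Ob) : A.Span X Y :=
  ⟨A.empty, A.emptyVer.to _, A.emptyHor.to _⟩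

/-- An object with a horizontal morphism to `∅` is `∅`, compatibly in both directions. -/
theorem exists_iso_empty_of_hor {P : A.Ob} (f : A.Hor P A.empty) :
    ∃ (a : A.HorIso A.empty P) (c : A.VerIso A.empty P), A.Corr a.hom c.hom := by
  let a : A.HorIso A.empty P :=
    { hom := A.emptyHor.to _
      inv := f
      hom_inv_id := A.emptyHor.hom_ext _ _
      inv_hom_id := by
        rw [← cancel_mono f, Category.assoc, A.emptyHor.hom_ext (A.emptyHor.to _ ≫ f) (𝟙 _)]
        simp }
  obtain ⟨c, hc⟩ := A.exists_verIso a
  exact ⟨a, c, hc⟩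

theorem exists_iso_empty_of_ver {P : A.Ob} (f : A.Ver P A.empty) :
    ∃ (a : A.HorIso A.empty P) (c : A.VerIso A.empty P), A.Corr a.hom c.hom := by
  obtain ⟨c, a, h⟩ := exists_iso_empty_of_hor (A := A.transpose) f
  exact ⟨a, c, h⟩

theorem rel_zeroSpan {X Y : A.Ob} (s : A.Span X Y)
    (h : ∃ (a : A.HorIso A.empty s.mid) (c : A.VerIso A.empty s.mid), A.Corr a.hom c.hom) :
    (A.zeroSpan X Y).Rel s := by
  obtain ⟨a, c, h⟩ := h
  exact ⟨a, c, h, A.emptyHor.hom_ext _ _, A.emptyVer.hom_ext _ _⟩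

instance (A : ACGWCategory.{u, v, w}) : HasZeroMorphisms A.Flat where
  zero X Y := ⟨(A.zeroSpan X.ob Y.ob).hom⟩
  comp_zero {X Y} f Z := by
    obtain ⟨s, rfl⟩ := Flat.exists_rep f
    refine (Span.hom_comp s (A.zeroSpan _ _) (s.comp_sq _)).trans (Eq.symm ?_)
    exact (Span.hom_eq_iff _ _).2
      (rel_zeroSpan _ (exists_iso_empty_of_hor (s.compTop (A.zeroSpan Y.ob Z.ob))))
  zero_comp X {Y Z} f := by
    obtain ⟨s, rfl⟩ := Flat.exists_rep f
    refine (Span.hom_comp (A.zeroSpan X.ob Y.ob) s (Span.comp_sq _ _)).trans (Eq.symm ?_)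
    exact (Span.hom_eq_iff _ _).2
      (rel_zeroSpan _ (exists_iso_empty_of_ver ((A.zeroSpan X.ob Y.ob).compLeft s)))

theorem zero_eq (X Y : A.Ob) : (0 : (⟨X⟩ : A.Flat) ⟶ ⟨Y⟩) = (A.zeroSpan X Y).hom := rfl

/-! ### Complements -/

section Complements

variable {X Y Z W I J : A.Ob}

/-- The square over `x` whose upper side is the identity of `∅`. -/
theorem sq_empty_left (x : A.Hor I W) :
    A.Sq (𝟙 _) (A.emptyVer.to ⟨I⟩) (A.emptyVer.to ⟨W⟩) x := by
  obtain ⟨P, t, l, h⟩ := exists_sq x (A.emptyVer.to ⟨W⟩)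
  obtain ⟨a, c, hac⟩ := exists_iso_empty_of_hor t
  have := sq_transport hac h
  rwa [A.emptyHor.hom_ext (a.hom ≫ t) (𝟙 _),
    A.emptyVer.hom_ext (c.hom ≫ l) (A.emptyVer.to ⟨I⟩)] at this

theorem isIso_ker_empty (I : A.Ob) : IsIso (A.ker (A.emptyVer.to ⟨I⟩)) := by
  obtain ⟨k, hk⟩ := exists_ker_of_sq (A.sq_coker (A.hid I))
  obtain ⟨a, ha⟩ := A.ker_coker (A.hid I)
  have : IsIso (A.ker (A.coker (A.hid I))) := by
    rw [← ha]; infer_instance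
  have h2 : IsIso (A.ker (A.emptyVer.to ⟨I⟩) ≫ A.hid I) := by
    have h3 : IsIso (A.ker (A.emptyVer.to ⟨I⟩)) := MorphismProperty.of_isPullback
      (P := MorphismProperty.isomorphisms _) hk.flip
      (MorphismProperty.isomorphisms.infer_property _)
    infer_instance
  simpa using h2

/-- If `m` and `e` meet in `∅` then `m` factors through the kernel of `e`. -/
theorem exists_factor_ker {m : A.Hor I X} {e : A.Ver J X}
    (h : A.Sq (A.emptyHor.to ⟨J⟩) (A.emptyVer.to ⟨I⟩) e m) :
    ∃ j : A.Hor I (A.kerObj e), j ≫ A.ker e = m := by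
  obtain ⟨k, hk⟩ := exists_ker_of_sq h
  have := isIso_ker_empty I
  exact ⟨inv (A.ker (A.emptyVer.to ⟨I⟩)) ≫ k, by rw [Category.assoc, ← hk.w]; simp⟩

/-- If `m` and `e` meet in `∅` then `e` factors through the cokernel of `m`. -/
theorem exists_factor_coker {m : A.Hor I X} {e : A.Ver J X}
    (h : A.Sq (A.emptyHor.to ⟨J⟩) (A.emptyVer.to ⟨I⟩) e m) :
    ∃ l : A.Ver J (A.cokerObj m), l ≫ A.coker m = e :=
  exists_factor_ker (A := A.transpose) h

/-- Taking cokernels reverses inclusions. -/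
theorem exists_coker_le {f : A.Hor W X} {j : A.Hor I X} (x : A.Hor I W) (h : x ≫ f = j) :
    ∃ y : A.Ver (A.cokerObj f) (A.cokerObj j), y ≫ A.coker j = A.coker f := by
  subst h
  apply exists_factor_coker
  simpa using A.sq_hcomp (sq_empty_left x) (A.sq_coker f)

/-- Taking kernels reverses inclusions. -/
theorem exists_ker_le {f : A.Ver W X} {j : A.Ver I X} (x : A.Ver I W) (h : x ≫ f = j) :
    ∃ y : A.Hor (A.kerObj f) (A.kerObj j), y ≫ A.ker j = A.ker f :=
  exists_coker_le (A := A.transpose) x h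

/-- The pseudo-commutative square on the cokernels of two sides of a horizontal pullback. -/
theorem exists_top_of_hor_isPullback {f : A.Hor X Z} {k : A.Hor X Y} {b : A.Hor Z W}
    {g : A.Hor Y W} (h : IsPullback f k b g) :
    ∃ t : A.Hor (A.cokerObj f) (A.cokerObj g), A.Sq t (A.coker f) (A.coker g) b := by
  obtain ⟨a, ha⟩ := A.ker_coker f
  obtain ⟨a', ha'⟩ := A.ker_coker g
  refine exists_top_of_isPullback (k := a.hom ≫ k ≫ a'.inv) ?_
  exact IsPullback.of_iso h a.symm (Iso.refl _) a'.symm (Iso.refl _)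
    (by simp [← ha]) (by simp) (by simp) (by simp [← ha'])

/-- The pseudo-commutative square on the kernels of two sides of a vertical pullback. -/
theorem exists_left_of_ver_isPullback {f : A.Ver X Z} {k : A.Ver X Y} {b : A.Ver Z W}
    {g : A.Ver Y W} (h : IsPullback f k b g) :
    ∃ l : A.Ver (A.kerObj f) (A.kerObj g), A.Sq (A.ker f) l b (A.ker g) :=
  exists_top_of_hor_isPullback (A := A.transpose) h

end Complements

/-! ### Homology at one spot -/

/-- A diagram `I ⟶ obj ⟵ J` (`I ⟶ obj` horizontal, `J ⟶ obj` vertical) whose legs meet in `∅`. -/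
structure Node (A : ACGWCategory.{u, v, w}) where
  obj : A.Ob
  I : A.Ob
  J : A.Ob
  m : A.Hor I obj
  e : A.Ver J obj
  sq : A.Sq (A.emptyHor.to ⟨J⟩) (A.emptyVer.to ⟨I⟩) e m

namespace Node

/-- The induced morphism from `I` to the kernel of `J ⟶ obj`. -/
noncomputable def toKer (N : A.Node) : A.Hor N.I (A.kerObj N.e) := (exists_factor_ker N.sq).choose

theorem toKer_ker (N : A.Node) : N.toKer ≫ A.ker N.e = N.m := (exists_factor_ker N.sq).choose_spec

/-- The induced morphism from `J` to the cokernel of `I ⟶ obj`. -/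
noncomputable def toCoker (N : A.Node) : A.Ver N.J (A.cokerObj N.m) :=
  (exists_factor_coker N.sq).choose

theorem toCoker_coker (N : A.Node) : N.toCoker ≫ A.coker N.m = N.e :=
  (exists_factor_coker N.sq).choose_spec

/-- The homology object: the cokernel of the induced morphism from `I` to the kernel of
`J ⟶ obj`. -/
noncomputable def H (N : A.Node) : A.Ob := A.cokerObj N.toKer

/-- The vertical morphism from the homology object to the kernel of `J ⟶ obj`. -/
noncomputable def hToKer (N : A.Node) : A.Ver N.H (A.kerObj N.e) := A.coker N.toKer

theorem exists_toCokerObj (N : A.Node) : ∃ t : A.Hor N.H (A.cokerObj N.m),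
    A.Sq t N.hToKer (A.coker N.m) (A.ker N.e) :=
  exists_top_of_hor_isPullback (k := 𝟙 _) (IsPullback.of_vert_isIso_mono ⟨by simp [toKer_ker]⟩)

/-- The horizontal morphism from the homology object to the cokernel of `I ⟶ obj`: the upper side
of the pseudo-commutative square
```
      H  ----->  obj ⫽ I
      |             |
  obj ⑊ J -----> obj
```
complementary to the square which says that the legs meet in `∅`. -/
noncomputable def hToCoker (N : A.Node) : A.Hor N.H (A.cokerObj N.m) := N.exists_toCokerObj.choose

theorem hToCoker_sq (N : A.Node) :
    A.Sq N.hToCoker N.hToKer (A.coker N.m) (A.ker N.e) := N.exists_toCokerObj.choose_spec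

/-- The homology object is also the kernel of the morphism from `J` to the cokernel of
`I ⟶ obj`: the order in which the two complements are taken does not matter. -/
theorem exists_iso_ker (N : A.Node) : ∃ (a : A.HorIso N.H (A.kerObj N.toCoker))
    (c : A.VerIso N.H (A.kerObj N.toCoker)),
      A.Corr a.hom c.hom ∧ a.hom ≫ A.ker N.toCoker = N.hToCoker := by
  obtain ⟨k, hk⟩ := exists_coker_of_sq N.hToCoker_sq
  obtain ⟨b, hb⟩ := A.coker_ker N.e
  obtain ⟨d, hd⟩ := A.ker_coker N.hToCoker
  obtain ⟨y, hy⟩ := exists_ker_le (f := N.toCoker) (j := A.coker N.hToCoker) (k ≫ b.hom)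
    (by rw [← cancel_mono (A.coker N.m), Category.assoc, toCoker_coker, Category.assoc, hb, hk.w])
  obtain ⟨y', hy'⟩ := exists_ker_le (f := A.coker N.hToCoker) (j := N.toCoker)
    (hk.lift N.toCoker b.inv (by rw [toCoker_coker, ← hb]; simp)) (hk.lift_fst _ _ _)
  let a : A.HorIso N.H (A.kerObj N.toCoker) :=
    { hom := d.inv ≫ y'
      inv := y ≫ d.hom
      hom_inv_id := by
        rw [← cancel_mono N.hToCoker]
        simp [hd, hy, hy', Iso.inv_comp_eq]
      inv_hom_id := by
        rw [← cancel_mono (A.ker N.toCoker)]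
        simp [hy, hy'] }
  obtain ⟨c, hc⟩ := A.exists_verIso a
  refine ⟨a, c, hc, ?_⟩
  simp [a, hy', Iso.inv_comp_eq, hd]

/-- A horizontal morphism of diagrams `I ⟶ obj ⟵ J`. -/
structure IsHorMap (N N' : A.Node) (f : A.Hor N.obj N'.obj) : Prop where
  exists_I : ∃ g : A.Hor N.I N'.I, g ≫ N'.m = N.m ≫ f
  exists_J : ∃ g : A.Hor N.J N'.J, A.Sq g N.e N'.e f

/-- A vertical morphism of diagrams `I ⟶ obj ⟵ J`. -/
structure IsVerMap (N N' : A.Node) (f : A.Ver N.obj N'.obj) : Prop where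
  exists_J : ∃ g : A.Ver N.J N'.J, g ≫ N'.e = N.e ≫ f
  exists_I : ∃ g : A.Ver N.I N'.I, A.Sq N.m g f N'.m

variable {N N' : A.Node}

namespace IsHorMap

variable {f : A.Hor N.obj N'.obj}

theorem exists_kerMap (hf : IsHorMap N N' f) :
    ∃ k : A.Hor (A.kerObj N.e) (A.kerObj N'.e), k ≫ A.ker N'.e = A.ker N.e ≫ f := by
  obtain ⟨g, hg⟩ := hf.exists_J
  obtain ⟨k, hk⟩ := exists_ker_of_sq hg
  exact ⟨k, hk.w.symm⟩

/-- The induced morphism of kernels. -/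
noncomputable def kerMap (hf : IsHorMap N N' f) : A.Hor (A.kerObj N.e) (A.kerObj N'.e) :=
  hf.exists_kerMap.choose

theorem kerMap_ker (hf : IsHorMap N N' f) : hf.kerMap ≫ A.ker N'.e = A.ker N.e ≫ f :=
  hf.exists_kerMap.choose_spec

/-- The intersection of `I'` with the kernel of `J ⟶ obj`, as a subobject of the latter. -/
noncomputable def inter (hf : IsHorMap N N' f) :
    A.Hor (pullback hf.kerMap N'.toKer).ob (A.kerObj N.e) := pullback.fst hf.kerMap N'.toKer

theorem exists_m (hf : IsHorMap N N' f) :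
    ∃ t : A.Hor (A.cokerObj hf.inter) N'.H,
      A.Sq t (A.coker hf.inter) N'.hToKer hf.kerMap :=
  exists_top_of_hor_isPullback (IsPullback.of_hasPullback hf.kerMap N'.toKer)

theorem exists_e (hf : IsHorMap N N' f) :
    ∃ y : A.Ver (A.cokerObj hf.inter) N.H, y ≫ N.hToKer = A.coker hf.inter := by
  obtain ⟨g, hg⟩ := hf.exists_I
  refine exists_coker_le (pullback.lift N.toKer g ?_) (pullback.lift_fst _ _ _)
  rw [← cancel_mono (A.ker N'.e), Category.assoc, kerMap_ker, Category.assoc, toKer_ker, hg,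
    ← Category.assoc, toKer_ker]

/-- The span induced on homology by a horizontal morphism: its middle object is the complement of
`inter`, its right leg is the upper side of the pseudo-commutative square complementary to the
pullback square defining `inter`, and its left leg is induced by the inclusion of `I` in `inter`. -/
noncomputable def span (hf : IsHorMap N N' f) : A.Span N.H N'.H :=
  ⟨A.cokerObj hf.inter, hf.exists_e.choose, hf.exists_m.choose⟩

theorem span_e (hf : IsHorMap N N' f) : hf.span.e ≫ N.hToKer = A.coker hf.inter :=
  hf.exists_e.choose_spec

theorem span_sq (hf : IsHorMap N N' f) :
    A.Sq hf.span.m (A.coker hf.inter) N'.hToKer hf.kerMap :=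
  hf.exists_m.choose_spec

end IsHorMap

namespace IsVerMap

variable {f : A.Ver N.obj N'.obj}

theorem exists_cokerMap (hf : IsVerMap N N' f) :
    ∃ k : A.Ver (A.cokerObj N.m) (A.cokerObj N'.m), k ≫ A.coker N'.m = A.coker N.m ≫ f := by
  obtain ⟨g, hg⟩ := hf.exists_I
  obtain ⟨k, hk⟩ := exists_coker_of_sq hg
  exact ⟨k, hk.w.symm⟩

/-- The induced morphism of cokernels. -/
noncomputable def cokerMap (hf : IsVerMap N N' f) : A.Ver (A.cokerObj N.m) (A.cokerObj N'.m) :=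
  hf.exists_cokerMap.choose

theorem cokerMap_coker (hf : IsVerMap N N' f) :
    hf.cokerMap ≫ A.coker N'.m = A.coker N.m ≫ f := hf.exists_cokerMap.choose_spec

/-- The intersection of `J'` with the cokernel of `I ⟶ obj`, as a (vertical) subobject of the
latter. -/
noncomputable def inter (hf : IsVerMap N N' f) :
    A.Ver (pullback hf.cokerMap N'.toCoker).ob (A.cokerObj N.m) :=
  pullback.fst hf.cokerMap N'.toCoker

theorem exists_m (hf : IsVerMap N N' f) :
    ∃ t : A.Hor (A.kerObj hf.inter) N.H, t ≫ N.hToCoker = A.ker hf.inter := by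
  obtain ⟨g, hg⟩ := hf.exists_J
  have hg' : N.toCoker ≫ hf.cokerMap = g ≫ N'.toCoker := by
    rw [← cancel_mono (A.coker N'.m), Category.assoc, cokerMap_coker, Category.assoc,
      toCoker_coker, hg, ← Category.assoc, toCoker_coker]
  obtain ⟨y, hy⟩ := exists_ker_le (f := hf.inter) (pullback.lift N.toCoker g hg')
    (pullback.lift_fst _ _ _)
  obtain ⟨a, c, -, ha⟩ := N.exists_iso_ker
  exact ⟨y ≫ a.inv, by simp [← ha, hy]⟩

theorem exists_e (hf : IsVerMap N N' f) :
    ∃ y : A.Ver (A.kerObj hf.inter) N'.H, A.Sq (A.ker hf.inter) y hf.cokerMap N'.hToCoker := by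
  obtain ⟨l, hl⟩ :=
    exists_left_of_ver_isPullback (IsPullback.of_hasPullback hf.cokerMap N'.toCoker)
  obtain ⟨a, c, hac, ha⟩ := N'.exists_iso_ker
  refine ⟨l ≫ c.inv, ?_⟩
  have h1 : A.Sq (A.ker N'.toCoker) c.inv (𝟙 _) N'.hToCoker := by
    have := A.sq_hcomp (corr_symm hac).1 (A.sq_vid N'.hToCoker)
    simpa [← ha] using this
  have h2 := A.sq_vcomp hl h1
  rw [Category.comp_id] at h2
  exact h2

/-- The span induced on homology by a vertical morphism `N ⟶ N'`, from the homology of `N'` to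
that of `N`: its middle object is the complement of `inter`, its left leg is the left side of the
pseudo-commutative square complementary to the pullback square defining `inter`, and its right leg
is induced by the inclusion of `J` in `inter`. -/
noncomputable def span (hf : IsVerMap N N' f) : A.Span N'.H N.H :=
  ⟨A.kerObj hf.inter, hf.exists_e.choose, hf.exists_m.choose⟩

theorem span_m (hf : IsVerMap N N' f) : hf.span.m ≫ N.hToCoker = A.ker hf.inter :=
  hf.exists_m.choose_spec

theorem span_sq (hf : IsVerMap N N' f) :
    A.Sq (A.ker hf.inter) hf.span.e hf.cokerMap N'.hToCoker := hf.exists_e.choose_spec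

end IsVerMap

end Node

/-! ### Chain complexes and their morphisms -/

theorem Span.hom_comp_eq_zero_iff {X Y Z : A.Ob} (s : A.Span X Y) (t : A.Span Y Z) :
    s.hom ≫ t.hom = 0 ↔ A.Sq (A.emptyHor.to ⟨t.mid⟩) (A.emptyVer.to ⟨s.mid⟩) t.e s.m := by
  constructor
  · intro h
    have h1 := (Span.hom_comp s t (s.comp_sq t)).symm.trans h
    rw [zero_eq, Span.hom_eq_iff] at h1
    obtain ⟨a, c, hac⟩ : ∃ (a : A.HorIso A.empty (s.compMid t))
        (c : A.VerIso A.empty (s.compMid t)), A.Corr a.hom c.hom := by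
      obtain ⟨a, c, hac, -, -⟩ := h1.symm
      exact ⟨a, c, hac⟩
    have := sq_transport hac (s.comp_sq t)
    rwa [A.emptyHor.hom_ext (a.hom ≫ s.compTop t) (A.emptyHor.to _),
      A.emptyVer.hom_ext (c.hom ≫ s.compLeft t) (A.emptyVer.to _)] at this
  · intro h
    refine (Span.hom_comp s t h).trans ?_
    rw [zero_eq, Span.hom_eq_iff]
    exact (rel_zeroSpan _ ⟨Iso.refl _, Iso.refl _, corr_id _⟩).symm

/-- A square of two spans and two horizontal morphisms commutes in `A^♭` if and only if it can be
subdivided into a pseudo-commutative square and a commutative square. -/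
theorem hor_comm_iff {P Q P' Q' : A.Ob} (s : A.Span P Q) (t : A.Span P' Q') (f : A.Hor P P')
    (f' : A.Hor Q Q') :
    (∃ g : A.Hor s.mid t.mid, A.Sq g s.e t.e f ∧ g ≫ t.m = s.m ≫ f') ↔
      ofHor f ≫ t.hom = s.hom ≫ ofHor f' := by
  constructor
  · rintro ⟨g, h1, h2⟩
    rw [Span.ofHor_comp f t h1, Span.comp_ofHor, h2]
  · intro h
    obtain ⟨R, p, q, hR⟩ := exists_sq f t.e
    rw [Span.ofHor_comp f t hR, Span.comp_ofHor, Span.hom_eq_iff] at h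
    obtain ⟨a, c, hac, h1, h2⟩ := h.symm
    refine ⟨a.hom ≫ p, ?_, by simpa using h1⟩
    have := sq_transport hac hR
    rwa [h2] at this

/-- The same for two vertical morphisms. -/
theorem ver_comm_iff {P Q P' Q' : A.Ob} (s : A.Span P Q) (t : A.Span P' Q') (f : A.Ver P P')
    (f' : A.Ver Q Q') :
    (∃ g : A.Ver s.mid t.mid, g ≫ t.e = s.e ≫ f ∧ A.Sq s.m g f' t.m) ↔
      ofVer f ≫ s.hom = t.hom ≫ ofVer f' := by
  constructor
  · rintro ⟨g, h1, h2⟩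
    rw [Span.ofVer_comp f s, Span.comp_ofVer t f' h2, h1]
  · intro h
    obtain ⟨R, p, q, hR⟩ := exists_sq t.m f'
    rw [Span.ofVer_comp f s, Span.comp_ofVer t f' hR, Span.hom_eq_iff] at h
    obtain ⟨a, c, hac, h1, h2⟩ := h
    refine ⟨c.hom ≫ q, by simpa using h2, ?_⟩
    have := sq_transport hac hR
    rwa [h1] at this

/-- Chain complexes in `A`: sequences `⋯ ⟶ X_{i+1} ⟶ X_i ⟶ X_{i-1} ⟶ ⋯` of morphisms of `A^♭`,
indexed by the integers, such that the composite of any two consecutive ones is zero.  Morphisms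
are sequences of morphisms of `A^♭` which commute with the differentials. -/
abbrev Ch (A : ACGWCategory.{u, v, w}) := ChainComplex A.Flat ℤ

/-- A span `X_i ⟵ X̄ ⟶ X_j` representing the differential. -/
noncomputable def Ch.dSpan (X : A.Ch) (i j : ℤ) : A.Span (X.X i).ob (X.X j).ob :=
  Flat.rep (X.d i j)

theorem Ch.dSpan_hom (X : A.Ch) (i j : ℤ) : (X.dSpan i j).hom = X.d i j := Flat.rep_hom _

/-- A morphism of chain complexes is given in each degree by a span `X_i ⟵ Z_i ⟶ Y_i`; it
commutes with the differentials if and only if there are diagrams made of two commutative squares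
and two pseudo-commutative squares. -/
theorem Ch.comm_iff {P Q P' Q' : A.Ob} (d : A.Span P Q) (d' : A.Span P' Q') (f : A.Span P P')
    (f' : A.Span Q Q') :
    f.hom ≫ d'.hom = d.hom ≫ f'.hom ↔
      ∃ z : A.Span f.mid f'.mid,
        (∃ g : A.Ver z.mid d.mid, g ≫ d.e = z.e ≫ f.e ∧ A.Sq z.m g f'.e d.m) ∧
        (∃ g : A.Hor z.mid d'.mid, A.Sq g z.e d'.e f.m ∧ g ≫ d'.m = z.m ≫ f'.m) := by
  constructor
  · intro h
    have h1 := d.comp_sq f'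
    have h2 := f.comp_sq d'
    have h3 := (Span.hom_comp f d' h2).symm.trans (h.trans (Span.hom_comp d f' h1))
    rw [Span.hom_eq_iff] at h3
    obtain ⟨a, c, hac, h4, h5⟩ := h3.symm
    have h6 := sq_transport hac h2
    refine ⟨⟨d.compMid f', c.hom ≫ f.compLeft d', d.compTop f'⟩,
      ⟨d.compLeft f', ?_, h1⟩, ⟨a.hom ≫ f.compTop d', h6, ?_⟩⟩
    · exact (h5.symm.trans (Category.assoc _ _ _).symm)
    · exact ((Category.assoc _ _ _).trans h4)
  · rintro ⟨z, ⟨g, h1, h2⟩, ⟨k, h3, h4⟩⟩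
    rw [Span.hom_comp f d' h3, Span.hom_comp d f' h2]
    unfold Span.glue
    rw [h1, h4]

/-- A horizontal morphism of chain complexes. -/
structure HorChainMap (X Y : A.Ch) where
  f : ∀ i, A.Hor (X.X i).ob (Y.X i).ob
  exists_bar : ∀ i j : ℤ, j + 1 = i → ∃ g : A.Hor (X.dSpan i j).mid (Y.dSpan i j).mid,
    A.Sq g (X.dSpan i j).e (Y.dSpan i j).e (f i) ∧
      g ≫ (Y.dSpan i j).m = (X.dSpan i j).m ≫ f j

/-- A vertical morphism of chain complexes. -/
structure VerChainMap (Z X : A.Ch) where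
  f : ∀ i, A.Ver (Z.X i).ob (X.X i).ob
  exists_bar : ∀ i j : ℤ, j + 1 = i → ∃ g : A.Ver (Z.dSpan i j).mid (X.dSpan i j).mid,
    g ≫ (X.dSpan i j).e = (Z.dSpan i j).e ≫ f i ∧
      A.Sq (Z.dSpan i j).m g (f j) (X.dSpan i j).m

/-- A horizontal morphism of chain complexes as a morphism of chain complexes. -/
def HorChainMap.toHom {X Y : A.Ch} (q : HorChainMap X Y) : X ⟶ Y where
  f i := ofHor (q.f i)
  comm' i j hij := by
    have h := (hor_comm_iff _ _ _ _).1 (q.exists_bar i j hij)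
    rwa [Ch.dSpan_hom, Ch.dSpan_hom] at h

/-- A vertical morphism of chain complexes as a morphism of chain complexes in the opposite
direction. -/
def VerChainMap.toHom {Z X : A.Ch} (p : VerChainMap Z X) : X ⟶ Z where
  f i := ofVer (p.f i)
  comm' i j hij := by
    have h := (ver_comm_iff _ _ _ _).1 (p.exists_bar i j hij)
    rwa [Ch.dSpan_hom, Ch.dSpan_hom] at h

/-- Every morphism of chain complexes `X ⟶ Y` is a span `X ⟵ Z ⟶ Y` of a vertical and a
horizontal morphism of chain complexes. -/
theorem Ch.exists_factorization {X Y : A.Ch} (f : X ⟶ Y) :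
    ∃ (Z : A.Ch) (p : VerChainMap Z X) (q : HorChainMap Z Y), p.toHom ≫ q.toHom = f := by
  let s : ∀ i, A.Span (X.X i).ob (Y.X i).ob := fun i => Flat.rep (f.f i)
  have hs : ∀ i, (s i).hom = f.f i := fun i => Flat.rep_hom _
  have hz : ∀ i j, ∃ z : A.Span (s i).mid (s j).mid,
      ofVer (s i).e ≫ z.hom = (X.dSpan i j).hom ≫ ofVer (s j).e ∧
      ofHor (s i).m ≫ (Y.dSpan i j).hom = z.hom ≫ ofHor (s j).m := by
    intro i j
    have h : (s i).hom ≫ (Y.dSpan i j).hom = (X.dSpan i j).hom ≫ (s j).hom := by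
      rw [Ch.dSpan_hom, Ch.dSpan_hom, hs, hs]
      exact f.comm i j
    obtain ⟨z, h1, h2⟩ := (Ch.comm_iff _ _ _ _).1 h
    exact ⟨z, (ver_comm_iff _ _ _ _).1 h1, (hor_comm_iff _ _ _ _).1 h2⟩
  choose z hz1 hz2 using hz
  let Z : A.Ch :=
    { X := fun i => ⟨(s i).mid⟩
      d := fun i j => (z i j).hom
      shape := fun i j hij => by
        rw [← cancel_epi (ofVer (s i).e), hz1, Ch.dSpan_hom, X.shape i j hij]
        simp
      d_comp_d' := fun i j k _ _ => by
        rw [← cancel_epi (ofVer (s i).e), ← Category.assoc, hz1, Category.assoc, hz1,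
          ← Category.assoc, Ch.dSpan_hom, Ch.dSpan_hom, X.d_comp_d]
        simp }
  refine ⟨Z, ⟨fun i => (s i).e, fun i j _ => ?_⟩, ⟨fun i => (s i).m, fun i j _ => ?_⟩, ?_⟩
  · rw [ver_comm_iff, Ch.dSpan_hom Z]
    exact hz1 i j
  · rw [hor_comm_iff, Ch.dSpan_hom Z]
    exact hz2 i j
  · ext i
    exact ((s i).hom_eq.symm.trans (hs i))

/-! ### Homology -/

/-- The part `X̄_{i+1} ⟶ X_i ⟵ X̄_i` of a chain complex. -/
noncomputable def Ch.node (X : A.Ch) (i : ℤ) : A.Node where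
  obj := (X.X i).ob
  I := (X.dSpan (i + 1) i).mid
  J := (X.dSpan i (i - 1)).mid
  m := (X.dSpan (i + 1) i).m
  e := (X.dSpan i (i - 1)).e
  sq := by
    rw [← Span.hom_comp_eq_zero_iff, Ch.dSpan_hom, Ch.dSpan_hom]
    exact X.d_comp_d _ _ _

/-- The `i`-th homology of a chain complex. -/
noncomputable def homology (i : ℤ) (X : A.Ch) : A.Flat := ⟨(X.node i).H⟩

theorem HorChainMap.isHorMap {X Y : A.Ch} (q : HorChainMap X Y) (i : ℤ) :
    Node.IsHorMap (X.node i) (Y.node i) (q.f i) where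
  exists_I := by
    obtain ⟨g, -, h⟩ := q.exists_bar (i + 1) i rfl
    exact ⟨g, h⟩
  exists_J := by
    obtain ⟨g, h, -⟩ := q.exists_bar i (i - 1) (sub_add_cancel i 1)
    exact ⟨g, h⟩

theorem VerChainMap.isVerMap {Z X : A.Ch} (p : VerChainMap Z X) (i : ℤ) :
    Node.IsVerMap (Z.node i) (X.node i) (p.f i) where
  exists_J := by
    obtain ⟨g, h, -⟩ := p.exists_bar i (i - 1) (sub_add_cancel i 1)
    exact ⟨g, h⟩
  exists_I := by
    obtain ⟨g, -, h⟩ := p.exists_bar (i + 1) i rfl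
    exact ⟨g, h⟩

/-- The morphism `H_i(X) ⟵ · ⟶ H_i(Y)` induced by a horizontal morphism of chain complexes. -/
noncomputable def homologyHor (i : ℤ) {X Y : A.Ch} (q : HorChainMap X Y) :
    homology i X ⟶ homology i Y := (q.isHorMap i).span.hom

/-- The morphism `H_i(X) ⟵ · ⟶ H_i(Z)` induced by a vertical morphism of chain complexes. -/
noncomputable def homologyVer (i : ℤ) {Z X : A.Ch} (p : VerChainMap Z X) :
    homology i X ⟶ homology i Z := (p.isVerMap i).span.hom

/-- The morphism induced on homology by a morphism of chain complexes `X ⟶ Y`, presented as a span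
`X ⟵ Z ⟶ Y` of a vertical and a horizontal morphism of chain complexes: the composite of the
morphisms induced by these two. -/
noncomputable def homologyMap (i : ℤ) {X Y : A.Ch} (f : X ⟶ Y) : homology i X ⟶ homology i Y :=
  homologyVer i (Ch.exists_factorization f).choose_spec.choose ≫
    homologyHor i (Ch.exists_factorization f).choose_spec.choose_spec.choose

/-- Homology, as an assignment on objects and morphisms. -/
noncomputable def homologyPrefunctor (A : ACGWCategory.{u, v, w}) (i : ℤ) : A.Ch ⥤q A.Flat where
  obj X := homology i X
  map f := homologyMap i f

end ACGWCategory

/-!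
In the flattening `A^♭` horizontal morphisms are monic, vertical morphisms (reversed) are epic, and
`ker e ⟶ X` and `X ⟶ coker m` have the universal properties of a kernel of `e` and of a cokernel of
`m` (`exists_lift_ofHor_ker`, `exists_desc_ofVer_coker`).  Homology can therefore be treated inside
`A^♭` as in an abelian category: writing `K` for the kernel of the outgoing differential and `Q` for
the cokernel of the incoming one, `H` is the image of `K ⟶ X_i ⟶ Q`, with an epimorphism `K ⟶ H`
and a monomorphism `H ⟶ Q`.

A morphism `f` of chain complexes then induces a morphism `K ⟶ K'` and, through it, a morphism
`H ⟶ H'` (`Node.exists_induces`).  This morphism is the only `φ` such that `K ⟶ H ⟶ H' ⟶ Q'` is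
`K ⟶ X_i ⟶ Y_i ⟶ Q'` (`Node.Induces.eq_of_comp_eq`), and induced morphisms compose.  The spans
attached to horizontal morphisms, by means of kernels, and to vertical morphisms, by means of
cokernels, both satisfy this equation (`Node.IsHorMap.toHomology_span`,
`Node.IsVerMap.toHomology_span`), so the composite attached to a presentation of `f` is the
morphism induced by `f`.  This gives the independence of the presentation as well as functoriality.
-/

namespace ACGWCategory

variable {A : ACGWCategory.{u, v, w}}

/-! ### Kernels and cokernels in the flattening -/

section Flattening

variable {X Y Z : A.Ob}

theorem ofHor_comp_ofHor (f : A.Hor X Y) (g : A.Hor Y Z) :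
    ofHor f ≫ ofHor g = ofHor (f ≫ g) :=
  Span.comp_ofHor ⟨X, 𝟙 _, f⟩ g

theorem ofVer_comp_ofVer (f : A.Ver Y X) (g : A.Ver Z Y) :
    ofVer f ≫ ofVer g = ofVer (g ≫ f) :=
  Span.ofVer_comp f ⟨Z, g, 𝟙 _⟩

theorem ofHor_comp_ofVer {P : A.Ob} {t : A.Hor P Y} {l : A.Ver P Z} {r : A.Ver Y X}
    {b : A.Hor Z X} (h : A.Sq t l r b) : ofHor b ≫ ofVer r = ofVer l ≫ ofHor t :=
  (Span.comp_ofVer ⟨Z, 𝟙 _, b⟩ r h).trans (by simpa using Span.hom_eq ⟨P, l, t⟩)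

theorem ofHor_comp_ofVer_eq_zero {m : A.Hor Y X} {e : A.Ver Z X}
    (h : A.Sq (A.emptyHor.to ⟨Z⟩) (A.emptyVer.to ⟨Y⟩) e m) : ofHor m ≫ ofVer e = 0 :=
  (Span.hom_comp_eq_zero_iff ⟨Y, 𝟙 _, m⟩ ⟨Z, e, 𝟙 _⟩).2 h

theorem exists_lift_ofHor_ker (e : A.Ver Z X) (g : (⟨Y⟩ : A.Flat) ⟶ ⟨X⟩) (h : g ≫ ofVer e = 0) :
    ∃ k : (⟨Y⟩ : A.Flat) ⟶ ⟨A.kerObj e⟩, k ≫ ofHor (A.ker e) = g := by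
  obtain ⟨s, rfl⟩ := Flat.exists_rep g
  obtain ⟨j, hj⟩ := exists_factor_ker ((Span.hom_comp_eq_zero_iff s ⟨Z, e, 𝟙 _⟩).1 h)
  exact ⟨Span.hom ⟨s.mid, s.e, j⟩, (Span.comp_ofHor _ _).trans (by rw [hj])⟩

theorem exists_desc_ofVer_coker (m : A.Hor Z X) (g : (⟨X⟩ : A.Flat) ⟶ ⟨Y⟩) (h : ofHor m ≫ g = 0) :
    ∃ k : (⟨A.cokerObj m⟩ : A.Flat) ⟶ ⟨Y⟩, ofVer (A.coker m) ≫ k = g := by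
  obtain ⟨s, rfl⟩ := Flat.exists_rep g
  obtain ⟨j, hj⟩ := exists_factor_coker ((Span.hom_comp_eq_zero_iff ⟨Z, 𝟙 _, m⟩ s).1 h)
  exact ⟨Span.hom ⟨s.mid, j, s.m⟩, (Span.ofVer_comp _ _).trans (by rw [hj])⟩

end Flattening

/-! ### Morphisms induced on homology -/

namespace Node

/-- The epimorphism of `A^♭` from the kernel of `J ⟶ obj` to the homology object. -/
noncomputable def toHomology (N : A.Node) : (⟨A.kerObj N.e⟩ : A.Flat) ⟶ ⟨N.H⟩ := ofVer N.hToKer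

/-- The monomorphism of `A^♭` from the homology object to the cokernel of `I ⟶ obj`. -/
noncomputable def ofHomology (N : A.Node) : (⟨N.H⟩ : A.Flat) ⟶ ⟨A.cokerObj N.m⟩ :=
  ofHor N.hToCoker

instance (N : A.Node) : Epi N.toHomology := inferInstanceAs (Epi (ofVer N.hToKer))

instance (N : A.Node) : Mono N.ofHomology := inferInstanceAs (Mono (ofHor N.hToCoker))

theorem toHomology_ofHomology (N : A.Node) :
    N.toHomology ≫ N.ofHomology = ofHor (A.ker N.e) ≫ ofVer (A.coker N.m) :=
  (ofHor_comp_ofVer N.hToCoker_sq).symm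

/-- `φ` is induced on homology by the morphism `f` of `A^♭`, by way of the kernels. -/
def Induces (N N' : A.Node) (f : (⟨N.obj⟩ : A.Flat) ⟶ ⟨N'.obj⟩)
    (φ : (⟨N.H⟩ : A.Flat) ⟶ ⟨N'.H⟩) : Prop :=
  ∃ κ : (⟨A.kerObj N.e⟩ : A.Flat) ⟶ ⟨A.kerObj N'.e⟩,
    κ ≫ ofHor (A.ker N'.e) = ofHor (A.ker N.e) ≫ f ∧ κ ≫ N'.toHomology = N.toHomology ≫ φ

theorem Induces.id (N : A.Node) : Induces N N (𝟙 _) (𝟙 _) := ⟨𝟙 _, by simp, by simp⟩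

theorem Induces.comp {N N' N'' : A.Node} {f : (⟨N.obj⟩ : A.Flat) ⟶ ⟨N'.obj⟩}
    {f' : (⟨N'.obj⟩ : A.Flat) ⟶ ⟨N''.obj⟩} {φ : (⟨N.H⟩ : A.Flat) ⟶ ⟨N'.H⟩}
    {φ' : (⟨N'.H⟩ : A.Flat) ⟶ ⟨N''.H⟩} (h : Induces N N' f φ) (h' : Induces N' N'' f' φ') :
    Induces N N'' (f ≫ f') (φ ≫ φ') := by
  obtain ⟨κ, h1, h2⟩ := h
  obtain ⟨κ', h1', h2'⟩ := h'
  refine ⟨κ ≫ κ', ?_, ?_⟩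
  · rw [Category.assoc, h1', reassoc_of% h1]
  · rw [Category.assoc, h2', reassoc_of% h2]

variable {N N' : A.Node} {f : (⟨N.obj⟩ : A.Flat) ⟶ ⟨N'.obj⟩} {φ ψ : (⟨N.H⟩ : A.Flat) ⟶ ⟨N'.H⟩}

theorem Induces.toHomology_comp (h : Induces N N' f φ) :
    N.toHomology ≫ φ ≫ N'.ofHomology = ofHor (A.ker N.e) ≫ f ≫ ofVer (A.coker N'.m) := by
  obtain ⟨κ, h1, h2⟩ := h
  rw [← reassoc_of% h2, toHomology_ofHomology, reassoc_of% h1]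

/-- An induced morphism is determined by the self-dual equation `toHomology_comp`, which refers
neither to a morphism of kernels nor to one of cokernels. -/
theorem Induces.eq_of_comp_eq (h : Induces N N' f φ)
    (hψ : N.toHomology ≫ ψ ≫ N'.ofHomology = ofHor (A.ker N.e) ≫ f ≫ ofVer (A.coker N'.m)) :
    ψ = φ := by
  rw [← cancel_mono N'.ofHomology, ← cancel_epi N.toHomology, hψ, h.toHomology_comp]

theorem Induces.unique (h : Induces N N' f φ) (h' : Induces N N' f ψ) : ψ = φ :=
  h.eq_of_comp_eq h'.toHomology_comp

/-- A morphism `f` induces a morphism on homology if it commutes with differentials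
`P ⟵ I ⟶ obj ⟵ J ⟶ Q` and `P' ⟵ I' ⟶ obj' ⟵ J' ⟶ Q'` on both sides. -/
theorem exists_induces {P P' Q Q' : A.Ob} {a : A.Ver N.I P} {a' : A.Ver N'.I P'}
    {b : A.Hor N.J Q} {b' : A.Hor N'.J Q'} {g : (⟨P⟩ : A.Flat) ⟶ ⟨P'⟩} {h : (⟨Q⟩ : A.Flat) ⟶ ⟨Q'⟩}
    (hg : g ≫ ofVer a' ≫ ofHor N'.m = (ofVer a ≫ ofHor N.m) ≫ f)
    (hh : f ≫ ofVer N'.e ≫ ofHor b' = (ofVer N.e ≫ ofHor b) ≫ h) : ∃ φ, Induces N N' f φ := by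
  have hker : ofHor (A.ker N.e) ≫ f ≫ ofVer N'.e = 0 := by
    have h0 : ofHor (A.ker N.e) ≫ ofVer N.e = 0 := ofHor_comp_ofVer_eq_zero (A.sq_ker _)
    rw [← cancel_mono (ofHor b'), zero_comp, Category.assoc, Category.assoc, hh, Category.assoc,
      reassoc_of% h0, zero_comp]
  have him : ofHor N.m ≫ f ≫ ofVer (A.coker N'.m) = 0 := by
    have h0 : ofHor N'.m ≫ ofVer (A.coker N'.m) = 0 := ofHor_comp_ofVer_eq_zero (A.sq_coker _)
    rw [← cancel_epi (ofVer a), comp_zero, ← Category.assoc, ← Category.assoc, ← hg,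
      Category.assoc, Category.assoc, h0, comp_zero, comp_zero]
  obtain ⟨κ, hκ⟩ := exists_lift_ofHor_ker N'.e (ofHor (A.ker N.e) ≫ f)
    ((Category.assoc _ _ _).trans hker)
  obtain ⟨φ, hφ⟩ := exists_desc_ofVer_coker N.toKer (κ ≫ N'.toHomology) (by
    rw [← cancel_mono N'.ofHomology, Category.assoc, Category.assoc, toHomology_ofHomology,
      reassoc_of% hκ, ← Category.assoc, ofHor_comp_ofHor, toKer_ker, him, zero_comp])
  exact ⟨φ, κ, hκ, hφ.symm⟩

theorem IsHorMap.toHomology_span {g : A.Hor N.obj N'.obj} (hg : IsHorMap N N' g) :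
    N.toHomology ≫ hg.span.hom ≫ N'.ofHomology =
      ofHor (A.ker N.e) ≫ ofHor g ≫ ofVer (A.coker N'.m) := by
  have h1 : ofHor hg.kerMap ≫ N'.toHomology = N.toHomology ≫ hg.span.hom := by
    rw [toHomology, ofHor_comp_ofVer hg.span_sq, Span.hom_eq, toHomology, ← Category.assoc,
      ofVer_comp_ofVer, hg.span_e]
  refine Induces.toHomology_comp ⟨ofHor hg.kerMap, ?_, h1⟩
  rw [ofHor_comp_ofHor, hg.kerMap_ker, ofHor_comp_ofHor]

theorem IsVerMap.toHomology_span {g : A.Ver N'.obj N.obj} (hg : IsVerMap N' N g) :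
    N.toHomology ≫ hg.span.hom ≫ N'.ofHomology =
      ofHor (A.ker N.e) ≫ ofVer g ≫ ofVer (A.coker N'.m) := by
  have h1 : hg.span.hom ≫ N'.ofHomology = N.ofHomology ≫ ofVer hg.cokerMap := by
    rw [ofHomology, ofHomology, ofHor_comp_ofVer hg.span_sq, Span.hom_eq, Category.assoc,
      ofHor_comp_ofHor, hg.span_m]
    rfl
  rw [h1, ← Category.assoc, toHomology_ofHomology, Category.assoc, ofVer_comp_ofVer,
    ofVer_comp_ofVer, hg.cokerMap_coker]

end Node

/-! ### Morphisms of chain complexes -/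

theorem Ch.d_eq (X : A.Ch) (i j : ℤ) :
    X.d i j = ofVer (X.dSpan i j).e ≫ ofHor (X.dSpan i j).m :=
  (X.dSpan_hom i j).symm.trans (Span.hom_eq _)

theorem Ch.exists_induces (i : ℤ) {X Y : A.Ch} (f : X ⟶ Y) :
    ∃ φ, Node.Induces (X.node i) (Y.node i) (f.f i) φ := by
  have h := f.comm i (i - 1)
  have h' := f.comm (i + 1) i
  rw [Ch.d_eq, Ch.d_eq] at h h'
  exact Node.exists_induces h' h

/-- Whatever the presentation of a morphism of chain complexes by a vertical and a horizontal one,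
the composite of the morphisms attached to these two is the induced morphism. -/
theorem induces_homologyVer_comp_homologyHor (i : ℤ) {X Y Z : A.Ch} (p : VerChainMap Z X)
    (q : HorChainMap Z Y) : Node.Induces (X.node i) (Y.node i) ((p.toHom ≫ q.toHom).f i)
      (homologyVer i p ≫ homologyHor i q) := by
  obtain ⟨φ, hφ⟩ := Ch.exists_induces i p.toHom
  obtain ⟨ψ, hψ⟩ := Ch.exists_induces i q.toHom
  have h1 : homologyVer i p = φ := hφ.eq_of_comp_eq (p.isVerMap i).toHomology_span
  have h2 : homologyHor i q = ψ := hψ.eq_of_comp_eq (q.isHorMap i).toHomology_span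
  rw [h1, h2]
  exact hφ.comp hψ

theorem induces_homologyMap (i : ℤ) {X Y : A.Ch} (f : X ⟶ Y) :
    Node.Induces (X.node i) (Y.node i) (f.f i) (homologyMap i f) := by
  have h := induces_homologyVer_comp_homologyHor i
    (Ch.exists_factorization f).choose_spec.choose
    (Ch.exists_factorization f).choose_spec.choose_spec.choose
  rwa [(Ch.exists_factorization f).choose_spec.choose_spec.choose_spec] at h

end ACGWCategory

theorem theorem4p7 (A : ACGWCategory.{u, v, w}) (i : ℤ) :
    (∃ F : A.Ch ⥤ A.Flat, F.toPrefunctor = A.homologyPrefunctor i) ∧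
      ∀ (X Y Z : A.Ch) (p : ACGWCategory.VerChainMap Z X) (q : ACGWCategory.HorChainMap Z Y),
        ACGWCategory.homologyMap i (p.toHom ≫ q.toHom) =
          ACGWCategory.homologyVer i p ≫ ACGWCategory.homologyHor i q := by
  refine ⟨⟨{ A.homologyPrefunctor i with
             map_id := fun X => ?_
             map_comp := fun f g => ?_ }, rfl⟩, fun X Y Z p q => ?_⟩
  · exact (ACGWCategory.Node.Induces.id (X.node i)).unique
      (ACGWCategory.induces_homologyMap i (𝟙 X))
  · exact ((ACGWCategory.induces_homologyMap i f).comp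
      (ACGWCategory.induces_homologyMap i g)).unique (ACGWCategory.induces_homologyMap i (f ≫ g))
  · exact (ACGWCategory.induces_homologyVer_comp_homologyHor i p q).unique
      (ACGWCategory.induces_homologyMap i _)
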